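/- Let $T>0$, $d\ge 0$, $1<p<\infty$, $0<\alpha\le 1$ with $1/p+\alpha>1$, and let $g:[0,T]\to\mathbb R$ be $\alpha$-Hölder continuous. Let $\mathrm{Conv}(\mathbb R^d)$ be the family of nonempty compact convex subsets of $\mathbb R^d$ (with Euclidean norm $\|\cdot\|$), with Minkowski addition and the Hausdorff metric $H$. A map $F:[0,T]\to\mathrm{Conv}(\mathbb R^d)$ is Hukuhara differentiable if for every $t\in[0,T]$ there is $D_HF(t)\in\mathrm{Conv}(\mathbb R^d)$ such that, for all small $h>0$, the Hukuhara differences $F(t+h)\div F(t)$ and $F(t)\div F(t-h)$ exist (where $A\div B=C$ means $A=B+C$ with $C\in\mathrm{Conv}(\mathbb R^d)$) and, divided by $h$, converge to $D_HF(t)$ in $H$ as $h\to0+$ (only the meaningful one of the two limits being required at $t=0$ and $t=T$). Its derivative is bounded if $\sup_{t\in[0,T]}H(D_HF(t),\{0\})<\infty$. Let $\mathcal{IS}(F)$ be the set of all $f:[0,T]\to\mathbb R^d$ of bounded Riesz $p$-variation, $$\sup_{0=t_0<\dots<t_m=T}\ \sum_{i=1}^m\frac{\|f(t_i)-f(t_{i-1})\|^p}{(t_i-t_{i-1})^{p-1}}<\infty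 ,$$ such that $f(t)\in F(t)$ for all $t\in[0,T]$, $f'\in L^p([0,T],\mathbb R^d)$ and $f'(t)\in D_HF(t)$ for a.e. $t\in[0,T]$. The set-valued Young integral is $$(\mathcal{IS})\int_0^tF\,dg=\mathrm{cl}\Big\{\int_0^tf\,dg:\ f\in\mathcal{IS}(F)\Big\},\qquad t\in[0,T],$$ where $\int_0^tf\,dg$ is the limit of the Riemann sums $\sum_i f(t_{i-1})(g(t_i)-g(t_{i-1}))$ over partitions of $[0,t]$ as the mesh tends to $0$. Let $F$ and $F_n$, $n\in\mathbb N$, be Hukuhara differentiable maps $[0,T]\to\mathrm{Conv}(\mathbb R^d)$ with bounded Hukuhara derivatives, such that $H(F_n(0),F(0))\to0$ (for instance, all with the same initial value). If $$\sup_{t\in[0,T]}H\big(D_HF_n(t),D_HF(t)\big)\to0\quad\text{as } n\to\infty,$$ then $$\sup_{t\in[0,T]}H\Big((\mathcal{IS})\int_0^tF_n\,dg,\ (\mathcal{IS})\int_0^tF\,dg\Big)\to0\quad\text{as } n\to\infty.$$ -/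

import Mathlib

open MeasureTheory Filter Set
open scoped NNReal ENNReal Topology

noncomputable section

namespace SetYoung

/-- A finite partition `a = t₀ < t₁ < ... < t_m = b` of `[a, b]`. Only the values `pt 0, ..., pt m`
matter; `m = 0` is possible only if `a = b`. -/
structure Partition (a b : ℝ) where
  /-- the number of intervals -/
  m : ℕ
  /-- the division points -/
  pt : ℕ → ℝ
  pt_zero : pt 0 = a
  pt_last : pt m = b
  lt_succ : ∀ i, i < m → pt i < pt (i + 1)

/-- The Riesz `p`-variation of `f` on `[a, b]`. -/
def rieszVariation {X : Type*} [PseudoMetricSpace X] (p : ℝ) (f : ℝ → X) (a b : ℝ) : ℝ≥0∞ :=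
  ⨆ P : Partition a b, ENNReal.ofReal (∑ i ∈ Finset.range P.m,
    dist (f (P.pt i)) (f (P.pt (i + 1))) ^ p / (P.pt (i + 1) - P.pt i) ^ (p - 1))

/-- The left-endpoint Riemann sum of `f` with respect to the integrator `g`. -/
def riemannSum {E : Type*} [AddCommGroup E] [Module ℝ E] (f : ℝ → E) (g : ℝ → ℝ) {a b : ℝ}
    (P : Partition a b) : E :=
  ∑ i ∈ Finset.range P.m, (g (P.pt (i + 1)) - g (P.pt i)) • f (P.pt i)

section

variable {E : Type*} [NormedAddCommGroup E] [NormedSpace ℝ E]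

/-- The Young integral of `f` with respect to `g` over `[a, b]` exists and equals `I`: the Riemann
sums converge to `I` as the mesh of the partition tends to zero. -/
def HasYoungIntegral (f : ℝ → E) (g : ℝ → ℝ) (a b : ℝ) (I : E) : Prop :=
  ∀ ε : ℝ, 0 < ε → ∃ δ : ℝ, 0 < δ ∧ ∀ P : Partition a b,
    (∀ i, i < P.m → P.pt (i + 1) - P.pt i < δ) → ‖riemannSum f g P - I‖ < ε

/-- `C` is the Hukuhara difference of `A` and `B` (Minkowski sum on the right). -/
def IsHukuharaDiff (A B C : ConvexBody E) : Prop := A = B + C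

/-- `D` is the Hukuhara derivative at `t` of `F : [0, T] → Conv E`: the difference quotients
`(F (t + h) ÷ F t) / h` and `(F t ÷ F (t - h)) / h` exist for all small `h > 0` and tend to `D` in
the Hausdorff metric as `h → 0+`. Only points of `[0, T]` are used, so at an endpoint of the
interval one of the two limits is void. -/
def HasHukuharaDerivAt (T : ℝ) (F : ℝ → ConvexBody E) (D : ConvexBody E) (t : ℝ) : Prop :=
  ∀ ε : ℝ, 0 < ε → ∃ δ : ℝ, 0 < δ ∧ ∀ h : ℝ, 0 < h → h < δ →
    (t + h ≤ T → ∃ C, IsHukuharaDiff (F (t + h)) (F t) C ∧ dist (h⁻¹ • C) D < ε) ∧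
    (0 ≤ t - h → ∃ C, IsHukuharaDiff (F t) (F (t - h)) C ∧ dist (h⁻¹ • C) D < ε)

/-- `F` is Hukuhara differentiable on `[0, T]`. -/
def HukuharaDifferentiable (T : ℝ) (F : ℝ → ConvexBody E) : Prop :=
  ∀ t ∈ Icc 0 T, ∃ D, HasHukuharaDerivAt T F D t

open Classical in
/-- The Hukuhara derivative `D_H F`; the value is `{0}` where `F` has no Hukuhara derivative. -/
def hukuharaDeriv (T : ℝ) (F : ℝ → ConvexBody E) (t : ℝ) : ConvexBody E :=
  if h : ∃ D, HasHukuharaDerivAt T F D t then h.choose else 0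

/-- `F` has a bounded Hukuhara derivative on `[0, T]`; here `dist A 0` is `H(A, {0})`. -/
def BoundedHukuharaDeriv (T : ℝ) (F : ℝ → ConvexBody E) : Prop :=
  ∃ M : ℝ, ∀ t ∈ Icc 0 T, dist (hukuharaDeriv T F t) 0 ≤ M

/-- `S_{V_p}(F)`: the selections of `F` on `[0, T]` of bounded Riesz `p`-variation. -/
def rieszSelections (p T : ℝ) (F : ℝ → ConvexBody E) : Set (ℝ → E) :=
  {f | rieszVariation p f 0 T < ∞ ∧ ∀ t ∈ Icc 0 T, f t ∈ F t}

/-- `S_{L^p}(Φ)`: the `p`-integrable almost everywhere selections of `Φ` on `[0, T]`. -/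
def lpSelections (p T : ℝ) (Φ : ℝ → ConvexBody E) : Set (ℝ → E) :=
  {φ | MemLp φ (ENNReal.ofReal p) (volume.restrict (Icc 0 T)) ∧
    ∀ᵐ t ∂volume.restrict (Icc 0 T), φ t ∈ Φ t}

/-- `IS(F)`: the selections `f ∈ S_{V_p}(F)` with `f' ∈ S_{L^p}(D_H F)`. -/
def integralSelections (p T : ℝ) (F : ℝ → ConvexBody E) : Set (ℝ → E) :=
  {f | f ∈ rieszSelections p T F ∧ ∃ φ ∈ lpSelections p T (hukuharaDeriv T F),
    ∀ᵐ t ∂volume.restrict (Icc 0 T), HasDerivAt f (φ t) t}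

/-- The set-valued Young integral `(IS)∫₀ᵗ F dg`. -/
def setYoungIntegral (p T : ℝ) (F : ℝ → ConvexBody E) (g : ℝ → ℝ) (t : ℝ) : Set E :=
  closure {I | ∃ f ∈ integralSelections p T F, HasYoungIntegral f g 0 t I}

end

end SetYoung

end

/-! The theorem follows from a quantitative estimate: if `F 0`, `G 0` are within `ε` in the
Hausdorff metric and so are the Hukuhara derivatives at every time, then the set-valued integrals at
each `t` are within `B * (1 + T) * ε`, where `B` bounds the oscillation of `g`.

Given a selection `f` of `F` with derivative `φ`, project `φ s` onto the nearest point `z s` of the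
derivative of `G`, choose `c₀ ∈ G 0` close to `f 0`, and put `k t = c₀ + ∫₀ᵗ z`. Support functions
turn Hukuhara derivatives into ordinary ones, so integrating `⟪u, z s⟫` against every direction `u`
shows `k t ∈ G t` (`add_integral_mem`). Measurability of `z` is `measurable_nearestPoint`.

Finite Riesz variation makes `f` absolutely continuous, hence `f t = f 0 + ∫₀ᵗ φ`, and `k - f` is a
constant plus the primitive of some `ψ`, both of size at most `ε`. Integration by parts gives the
Young integral of such a primitive and bounds it by `B` (`hasYoungIntegral_primitive`,
`norm_partsIntegral_le`). The argument is symmetric in `F` and `G`. -/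

namespace SetYoung

open scoped Pointwise

/-! ### Support functions and nearest points of convex bodies. -/

section SupportFunction

variable {E : Type*} [NormedAddCommGroup E] [InnerProductSpace ℝ E]

/-- The support function `u ↦ max {⟪u, x⟫ : x ∈ A}` of a convex body. -/
noncomputable def supportFun (A : ConvexBody E) (u : E) : ℝ :=
  sSup ((fun x => inner ℝ u x) '' (A : Set E))

lemma isCompact_image_inner (A : ConvexBody E) (u : E) :
    IsCompact ((fun x => inner ℝ u x) '' (A : Set E)) :=
  A.isCompact.image (by fun_prop)

lemma inner_le_supportFun {A : ConvexBody E} {x : E} (hx : x ∈ A) (u : E) :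
    inner ℝ u x ≤ supportFun A u :=
  le_csSup (isCompact_image_inner A u).bddAbove ⟨x, hx, rfl⟩

lemma supportFun_le {A : ConvexBody E} {u : E} {c : ℝ} (h : ∀ x ∈ A, inner ℝ u x ≤ c) :
    supportFun A u ≤ c := by
  refine csSup_le (A.nonempty.image _) ?_
  rintro _ ⟨x, hx, rfl⟩
  exact h x hx

lemma exists_inner_eq_supportFun (A : ConvexBody E) (u : E) :
    ∃ x ∈ A, inner ℝ u x = supportFun A u := by
  obtain ⟨x, hx, h⟩ := (isCompact_image_inner A u).sSup_mem (A.nonempty.image _)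
  exact ⟨x, hx, h⟩

lemma supportFun_add (A B : ConvexBody E) (u : E) :
    supportFun (A + B) u = supportFun A u + supportFun B u := by
  refine le_antisymm (supportFun_le fun x hx => ?_) ?_
  · obtain ⟨a, ha, b, hb, rfl⟩ : x ∈ (A : Set E) + (B : Set E) := hx
    rw [inner_add_right]
    exact add_le_add (inner_le_supportFun ha u) (inner_le_supportFun hb u)
  · obtain ⟨a, ha, ha'⟩ := exists_inner_eq_supportFun A u
    obtain ⟨b, hb, hb'⟩ := exists_inner_eq_supportFun B u
    rw [← ha', ← hb', ← inner_add_right]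
    exact inner_le_supportFun (show a + b ∈ (A : Set E) + (B : Set E) from Set.add_mem_add ha hb) u

lemma supportFun_smul {c : ℝ} (hc : 0 ≤ c) (A : ConvexBody E) (u : E) :
    supportFun (c • A) u = c * supportFun A u := by
  refine le_antisymm (supportFun_le fun x hx => ?_) ?_
  · obtain ⟨a, ha, rfl⟩ : x ∈ c • (A : Set E) := hx
    rw [inner_smul_right]
    exact mul_le_mul_of_nonneg_left (inner_le_supportFun ha u) hc
  · obtain ⟨a, ha, ha'⟩ := exists_inner_eq_supportFun A u
    rw [← ha', ← inner_smul_right]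
    exact inner_le_supportFun (show c • a ∈ c • (A : Set E) from Set.smul_mem_smul_set ha) u

@[simp]
lemma supportFun_zero (u : E) : supportFun (0 : ConvexBody E) u = 0 := by
  obtain ⟨x, hx, h⟩ := exists_inner_eq_supportFun (0 : ConvexBody E) u
  obtain rfl : x = 0 := hx
  rw [← h, inner_zero_right]

lemma exists_mem_dist_le {A B : ConvexBody E} {x : E} (hx : x ∈ A) :
    ∃ y ∈ B, dist x y ≤ dist A B := by
  obtain ⟨y, hy, h⟩ := B.isCompact.exists_infDist_eq_dist B.nonempty x
  exact ⟨y, hy, h ▸ Metric.infDist_le_hausdorffDist_of_mem hx ConvexBody.hausdorffEDist_ne_top⟩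

lemma norm_le_dist_zero {A : ConvexBody E} {x : E} (hx : x ∈ A) : ‖x‖ ≤ dist A 0 := by
  obtain ⟨y, hy, h⟩ := exists_mem_dist_le (B := 0) hx
  obtain rfl : y = 0 := hy
  simpa using h

lemma supportFun_le_add_dist (A B : ConvexBody E) (u : E) :
    supportFun A u ≤ supportFun B u + ‖u‖ * dist A B := by
  refine supportFun_le fun x hx => ?_
  obtain ⟨y, hy, h⟩ := exists_mem_dist_le (B := B) hx
  calc inner ℝ u x = inner ℝ u y + inner ℝ u (x - y) := by rw [inner_sub_right]; ring
    _ ≤ supportFun B u + ‖u‖ * ‖x - y‖ :=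
      add_le_add (inner_le_supportFun hy u) (real_inner_le_norm _ _)
    _ ≤ _ := by rw [← dist_eq_norm]; gcongr

lemma abs_supportFun_sub_le (A B : ConvexBody E) (u : E) :
    |supportFun A u - supportFun B u| ≤ ‖u‖ * dist A B := by
  have h₁ := supportFun_le_add_dist A B u
  have h₂ := supportFun_le_add_dist B A u
  rw [dist_comm] at h₂
  exact abs_sub_le_iff.2 ⟨by linarith, by linarith⟩

lemma continuous_supportFun (A : ConvexBody E) : Continuous (supportFun A) := by
  refine (LipschitzWith.of_le_add_mul (Real.toNNReal (dist A 0)) fun u v =>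
    supportFun_le fun x hx => ?_).continuous
  rw [Real.coe_toNNReal _ dist_nonneg]
  calc inner ℝ u x = inner ℝ v x + inner ℝ (u - v) x := by rw [inner_sub_left]; ring
    _ ≤ supportFun A v + ‖u - v‖ * ‖x‖ :=
      add_le_add (inner_le_supportFun hx v) (real_inner_le_norm _ _)
    _ ≤ supportFun A v + dist A 0 * dist u v := by
      rw [← dist_eq_norm, mul_comm]
      gcongr
      exact norm_le_dist_zero hx

lemma exists_nearestPoint (A : ConvexBody E) (x : E) :
    ∃ z ∈ A, ∀ y ∈ A, inner ℝ (x - z) (y - z) ≤ 0 := by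
  obtain ⟨z, hz, h⟩ :=
    exists_norm_eq_iInf_of_complete_convex A.nonempty A.isCompact.isComplete A.convex x
  exact ⟨z, hz, (norm_eq_iInf_iff_real_inner_le_zero A.convex hz).1 h⟩

/-- The point of the convex body `A` that is nearest to `x`. -/
noncomputable def nearestPoint (A : ConvexBody E) (x : E) : E :=
  (exists_nearestPoint A x).choose

lemma nearestPoint_mem (A : ConvexBody E) (x : E) : nearestPoint A x ∈ A :=
  (exists_nearestPoint A x).choose_spec.1

lemma inner_sub_nearestPoint_le {A : ConvexBody E} (x : E) {y : E} (hy : y ∈ A) :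
    inner ℝ (x - nearestPoint A x) (y - nearestPoint A x) ≤ 0 :=
  (exists_nearestPoint A x).choose_spec.2 y hy

lemma norm_sub_nearestPoint_le {A : ConvexBody E} (x : E) {y : E} (hy : y ∈ A) :
    ‖x - nearestPoint A x‖ ≤ ‖x - y‖ := by
  set z := nearestPoint A x
  have h : inner ℝ (x - z) (y - z) ≤ 0 := inner_sub_nearestPoint_le x hy
  refine le_of_sq_le_sq ?_ (norm_nonneg _)
  have h₁ : x - y = (x - z) - (y - z) := by abel
  rw [h₁, norm_sub_sq_real (x - z)]
  nlinarith [sq_nonneg ‖y - z‖]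

lemma norm_nearestPoint_sub_le (A : ConvexBody E) (x y : E) :
    ‖nearestPoint A x - nearestPoint A y‖ ≤ ‖x - y‖ := by
  set z := nearestPoint A x with hz
  set w := nearestPoint A y with hw
  have h₁ : inner ℝ (x - z) (w - z) ≤ 0 := inner_sub_nearestPoint_le x (nearestPoint_mem A y)
  have h₂ : inner ℝ (y - w) (z - w) ≤ 0 := inner_sub_nearestPoint_le y (nearestPoint_mem A x)
  have h₃ : ‖z - w‖ ^ 2 ≤ inner ℝ (x - y) (z - w) := by
    rw [← real_inner_self_eq_norm_sq]
    simp only [inner_sub_left, inner_sub_right] at *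
    linarith
  have h₄ := real_inner_le_norm (x - y) (z - w)
  by_contra! h
  have := norm_nonneg (x - y)
  nlinarith

/-- Dual description of the distance to `A`. The direction `u = x - z` is the decisive one, since
`A` attains its support value there at `z`. In this form the distance is governed by inequalities
between support functions. -/
lemma norm_sub_nearestPoint_le_iff (A : ConvexBody E) (x : E) {c : ℝ} (hc : 0 ≤ c) :
    ‖x - nearestPoint A x‖ ≤ c ↔ ∀ u, inner ℝ u x ≤ supportFun A u + c * ‖u‖ := by
  set z := nearestPoint A x with hz
  constructor
  · intro h u
    calc inner ℝ u x = inner ℝ u z + inner ℝ u (x - z) := by rw [inner_sub_right]; ring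
      _ ≤ supportFun A u + ‖u‖ * ‖x - z‖ :=
        add_le_add (inner_le_supportFun (nearestPoint_mem A x) u) (real_inner_le_norm _ _)
      _ ≤ _ := by rw [mul_comm c]; gcongr
  · intro h
    have h₁ : supportFun A (x - z) ≤ inner ℝ (x - z) z := supportFun_le fun y hy => by
      have : inner ℝ (x - z) (y - z) ≤ 0 := inner_sub_nearestPoint_le x hy
      rw [inner_sub_right] at this
      linarith
    have h₂ : ‖x - z‖ ^ 2 ≤ c * ‖x - z‖ := by
      rw [← real_inner_self_eq_norm_sq, inner_sub_right]
      linarith [h (x - z)]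
    by_contra! h₃
    nlinarith

lemma mem_of_inner_le_supportFun {A : ConvexBody E} {x : E}
    (h : ∀ u, inner ℝ u x ≤ supportFun A u) : x ∈ A := by
  have h₁ := (norm_sub_nearestPoint_le_iff A x le_rfl).2 (by simpa using h)
  rw [sub_eq_zero.1 (norm_le_zero_iff.1 h₁)]
  exact nearestPoint_mem A x

/-- The convex function `x ↦ max {2⟪x, z⟫ - ‖z‖² : z ∈ A} = ‖x‖² - dist(x, A)²`, whose gradient is
twice the nearest-point map, satisfies the subgradient inequality. -/
lemma two_inner_nearestPoint_le (A : ConvexBody E) (x v : E) :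
    2 * inner ℝ v (nearestPoint A x) ≤
      (‖x + v‖ ^ 2 - ‖x + v - nearestPoint A (x + v)‖ ^ 2) -
        (‖x‖ ^ 2 - ‖x - nearestPoint A x‖ ^ 2) := by
  have h := norm_sub_nearestPoint_le (x + v) (nearestPoint_mem A x)
  have h₁ : ‖x + v - nearestPoint A (x + v)‖ ^ 2 ≤ ‖x + v - nearestPoint A x‖ ^ 2 := by gcongr
  rw [norm_sub_sq_real (x + v) (nearestPoint A x), inner_add_left] at h₁
  rw [norm_sub_sq_real x]
  linarith

end SupportFunction

/-! ### Measurability of the projection onto a moving convex body. -/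

section Measurability

variable {E Ω : Type*} [NormedAddCommGroup E] [InnerProductSpace ℝ E] [FiniteDimensional ℝ E]
  [MeasurableSpace E] [BorelSpace E] [MeasurableSpace Ω]

/-- Both sides of the dual inequality are continuous in `u`, so a countable dense set of directions
suffices. -/
lemma measurable_norm_sub_nearestPoint {A : Ω → ConvexBody E}
    (hA : ∀ u, Measurable fun s => supportFun (A s) u) {φ : Ω → E} (hφ : Measurable φ) :
    Measurable fun s => ‖φ s - nearestPoint (A s) (φ s)‖ := by
  refine measurable_of_Iic fun c => ?_
  rcases lt_or_ge c 0 with hc | hc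
  · convert MeasurableSet.empty (α := Ω)
    ext s
    simpa using hc.trans_le (norm_nonneg _)
  · have : (fun s => ‖φ s - nearestPoint (A s) (φ s)‖) ⁻¹' Iic c =
        ⋂ n, {s | inner ℝ (TopologicalSpace.denseSeq E n) (φ s) ≤
          supportFun (A s) (TopologicalSpace.denseSeq E n) +
            c * ‖TopologicalSpace.denseSeq E n‖} := by
      ext s
      simp only [mem_preimage, mem_Iic, norm_sub_nearestPoint_le_iff _ _ hc, mem_iInter,
        mem_ofPred_eq]
      refine ⟨fun h n => h _, fun h u => ?_⟩
      have hcl : IsClosed {u | inner ℝ u (φ s) ≤ supportFun (A s) u + c * ‖u‖} :=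
        isClosed_le (by fun_prop) ((continuous_supportFun (A s)).add (by fun_prop))
      have : closure (range (TopologicalSpace.denseSeq E)) ⊆
          {u | inner ℝ u (φ s) ≤ supportFun (A s) u + c * ‖u‖} :=
        closure_minimal (range_subset_iff.2 h) hcl
      exact this ((TopologicalSpace.denseRange_denseSeq E).closure_range ▸ mem_univ u)
    rw [this]
    exact MeasurableSet.iInter fun n =>
      measurableSet_le (measurable_const.inner hφ) ((hA _).add_const _)

/-- Each component `⟪v, ·⟫` of the projection is half a directional derivative of `‖x‖² - dist(x,
A)²`, hence a limit of measurable difference quotients. -/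
lemma measurable_nearestPoint {A : Ω → ConvexBody E}
    (hA : ∀ u, Measurable fun s => supportFun (A s) u) {φ : Ω → E} (hφ : Measurable φ) :
    Measurable fun s => nearestPoint (A s) (φ s) := by
  have key : ∀ v : E, Measurable fun s => inner ℝ v (nearestPoint (A s) (φ s)) := by
    intro v
    let θ : Ω → E → ℝ := fun s x => ‖x‖ ^ 2 - ‖x - nearestPoint (A s) x‖ ^ 2
    let a : ℕ → ℝ := fun n => 1 / ((n : ℝ) + 1)
    have ha : ∀ n, 0 < a n := fun n => Nat.one_div_pos_of_nat
    have ha0 : Tendsto a atTop (𝓝 0) := tendsto_one_div_add_atTop_nhds_zero_nat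
    refine measurable_of_tendsto_metrizable
      (f := fun n s => (θ s (φ s + a n • v) - θ s (φ s)) / (2 * a n)) (fun n => ?_) ?_
    · have h₁ : Measurable fun s => φ s + a n • v := hφ.add_const _
      exact (((h₁.norm.pow_const 2).sub ((measurable_norm_sub_nearestPoint hA h₁).pow_const 2)).sub
        ((hφ.norm.pow_const 2).sub
          ((measurable_norm_sub_nearestPoint hA hφ).pow_const 2))).div_const _
    · refine tendsto_pi_nhds.2 fun s => ?_
      have hup : Tendsto (fun n => inner ℝ v (nearestPoint (A s) (φ s)) + a n * ‖v‖ ^ 2)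
          atTop (𝓝 (inner ℝ v (nearestPoint (A s) (φ s)))) := by
        simpa using (ha0.mul_const (‖v‖ ^ 2)).const_add (inner ℝ v (nearestPoint (A s) (φ s)))
      refine tendsto_of_tendsto_of_tendsto_of_le_of_le tendsto_const_nhds hup (fun n => ?_)
        fun n => ?_
      · have h := two_inner_nearestPoint_le (A s) (φ s) (a n • v)
        rw [real_inner_smul_left] at h
        have := ha n
        rw [le_div_iff₀ (by positivity)]
        simp only [θ]
        linarith
      -- The subgradient inequality at the shifted point, in direction `-a n • v`, bounds the
      -- quotient above by the component at the shifted point; nonexpansiveness moves it back at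
      -- cost `a n * ‖v‖ ^ 2`.
      · have h := two_inner_nearestPoint_le (A s) (φ s + a n • v) (-(a n • v))
        have hn := norm_nearestPoint_sub_le (A s) (φ s + a n • v) (φ s)
        rw [add_neg_cancel_right, inner_neg_left, real_inner_smul_left] at h
        rw [add_sub_cancel_left, norm_smul, Real.norm_of_nonneg (ha n).le] at hn
        have hi := real_inner_le_norm v
          (nearestPoint (A s) (φ s + a n • v) - nearestPoint (A s) (φ s))
        rw [inner_sub_right] at hi
        have h2 : ‖v‖ * ‖nearestPoint (A s) (φ s + a n • v) - nearestPoint (A s) (φ s)‖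
            ≤ a n * ‖v‖ ^ 2 := by
          nlinarith [mul_le_mul_of_nonneg_left hn (norm_nonneg v)]
        have := ha n
        rw [div_le_iff₀ (by positivity)]
        simp only [θ]
        nlinarith
  let b := stdOrthonormalBasis ℝ E
  have : (fun s => nearestPoint (A s) (φ s)) =
      fun s => ∑ i, inner ℝ (b i) (nearestPoint (A s) (φ s)) • b i := by
    ext1 s
    exact (b.sum_repr' _).symm
  rw [this]
  exact Finset.measurable_fun_sum _ fun i _ => (key (b i)).smul_const _

end Measurability

/-! ### Hukuhara derivatives through support functions. -/

section Hukuhara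

variable {E : Type*} [NormedAddCommGroup E] [InnerProductSpace ℝ E]

/-- Support functions are additive, positively homogeneous and `‖u‖`-Lipschitz in the Hausdorff
metric, so Hukuhara difference quotients become ordinary ones. -/
lemma HasHukuharaDerivAt.hasDerivWithinAt_supportFun {T t : ℝ} {F : ℝ → ConvexBody E}
    {D : ConvexBody E} (hF : HasHukuharaDerivAt T F D t) (ht : t ∈ Icc 0 T) (u : E) :
    HasDerivWithinAt (fun s => supportFun (F s) u) (supportFun D u) (Icc 0 T) t := by
  rw [hasDerivWithinAt_iff_isLittleO, Asymptotics.isLittleO_iff]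
  intro c hc
  obtain ⟨δ, hδ, H⟩ := hF (c / (‖u‖ + 1)) (by positivity)
  have key : ∀ {h : ℝ} {A B C : ConvexBody E}, 0 < h → IsHukuharaDiff A B C →
      dist (h⁻¹ • C) D < c / (‖u‖ + 1) →
      |supportFun A u - supportFun B u - h * supportFun D u| ≤ c * h := by
    intro h A B C hh hC hd
    have h₁ : supportFun A u - supportFun B u = h * supportFun (h⁻¹ • C) u := by
      rw [show A = B + C from hC, supportFun_add, supportFun_smul (by positivity)]
      field_simp
      ring
    rw [h₁, ← mul_sub, abs_mul, abs_of_pos hh, mul_comm c]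
    refine mul_le_mul_of_nonneg_left ((abs_supportFun_sub_le _ _ _).trans ?_) hh.le
    rw [lt_div_iff₀ (by positivity)] at hd
    nlinarith [norm_nonneg u, dist_nonneg (x := h⁻¹ • C) (y := D)]
  have hball : ∀ᶠ s in 𝓝[Icc 0 T] t, dist s t < δ :=
    nhdsWithin_le_nhds (Metric.ball_mem_nhds t hδ)
  filter_upwards [hball, self_mem_nhdsWithin] with s hs hsT
  rw [Real.dist_eq] at hs
  rw [Real.norm_eq_abs, Real.norm_eq_abs, smul_eq_mul]
  rcases lt_trichotomy s t with h | rfl | h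
  · rw [abs_sub_comm, abs_of_pos (sub_pos.2 h)] at hs
    obtain ⟨C, hC, hd⟩ := (H (t - s) (sub_pos.2 h) hs).2 (by linarith [hsT.1])
    rw [sub_sub_cancel] at hC
    rw [abs_sub_comm s t, abs_of_pos (sub_pos.2 h)]
    refine le_of_eq_of_le ?_ (key (sub_pos.2 h) hC hd)
    rw [← abs_neg]
    congr 1
    ring
  · simp
  · rw [abs_of_pos (sub_pos.2 h)] at hs
    obtain ⟨C, hC, hd⟩ := (H (s - t) (sub_pos.2 h) hs).1 (by linarith [hsT.2])
    rw [add_sub_cancel] at hC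
    rw [abs_of_pos (sub_pos.2 h)]
    exact key (sub_pos.2 h) hC hd

lemma hasHukuharaDerivAt_hukuharaDeriv {T t : ℝ} {F : ℝ → ConvexBody E}
    (hF : HukuharaDifferentiable T F) (ht : t ∈ Icc 0 T) :
    HasHukuharaDerivAt T F (hukuharaDeriv T F t) t := by
  have h := hF t ht
  rw [hukuharaDeriv, dif_pos h]
  exact h.choose_spec

lemma hasDerivWithinAt_supportFun {T t : ℝ} {F : ℝ → ConvexBody E}
    (hF : HukuharaDifferentiable T F) (ht : t ∈ Icc 0 T) (u : E) :
    HasDerivWithinAt (fun s => supportFun (F s) u) (supportFun (hukuharaDeriv T F t) u)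
      (Icc 0 T) t :=
  (hasHukuharaDerivAt_hukuharaDeriv hF ht).hasDerivWithinAt_supportFun ht u

lemma hasDerivAt_supportFun {T t : ℝ} {F : ℝ → ConvexBody E}
    (hF : HukuharaDifferentiable T F) (ht : t ∈ Ioo 0 T) (u : E) :
    HasDerivAt (fun s => supportFun (F s) u) (supportFun (hukuharaDeriv T F t) u) t :=
  (hasDerivWithinAt_supportFun hF (Ioo_subset_Icc_self ht) u).hasDerivAt
    (Icc_mem_nhds ht.1 ht.2)

open Classical in
/-- The Hukuhara derivative on the open interval `(0, T)`, extended by `{0}`. -/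
noncomputable def interiorDeriv (T : ℝ) (F : ℝ → ConvexBody E) (t : ℝ) : ConvexBody E :=
  if t ∈ Ioo 0 T then hukuharaDeriv T F t else 0

/-- Inside `(0, T)` this is a classical `deriv`, which is always measurable; restricting to the open
interval avoids the one-sided derivatives at the endpoints. -/
lemma measurable_supportFun_interiorDeriv {T : ℝ} {F : ℝ → ConvexBody E}
    (hF : HukuharaDifferentiable T F) (u : E) :
    Measurable fun t => supportFun (interiorDeriv T F t) u := by
  have : (fun t => supportFun (interiorDeriv T F t) u) =
      (Ioo 0 T).indicator (deriv fun s => supportFun (F s) u) := by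
    ext t
    by_cases ht : t ∈ Ioo 0 T
    · rw [indicator_of_mem ht, interiorDeriv, if_pos ht, (hasDerivAt_supportFun hF ht u).deriv]
    · rw [indicator_of_notMem ht, interiorDeriv, if_neg ht, supportFun_zero]
  rw [this]
  exact (measurable_deriv _).indicator measurableSet_Ioo

lemma BoundedHukuharaDeriv.exists_dist_interiorDeriv_le {T : ℝ} {F : ℝ → ConvexBody E}
    (hF : BoundedHukuharaDeriv T F) : ∃ M : ℝ, 0 ≤ M ∧ ∀ t, dist (interiorDeriv T F t) 0 ≤ M := by
  obtain ⟨M, hM⟩ := hF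
  refine ⟨max M 0, le_max_right _ _, fun t => ?_⟩
  by_cases ht : t ∈ Ioo 0 T
  · rw [interiorDeriv, if_pos ht]
    exact (hM t (Ioo_subset_Icc_self ht)).trans (le_max_left _ _)
  · rw [interiorDeriv, if_neg ht, dist_self]
    exact le_max_right _ _

lemma ae_restrict_Icc_mem_Ioo (T : ℝ) :
    ∀ᵐ t ∂(volume : Measure ℝ).restrict (Icc 0 T), t ∈ Ioo 0 T := by
  rw [← restrict_Ioo_eq_restrict_Icc]
  exact ae_restrict_mem measurableSet_Ioo

lemma integral_supportFun_interiorDeriv {T t : ℝ} {F : ℝ → ConvexBody E}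
    (hF : HukuharaDifferentiable T F) (hFb : BoundedHukuharaDeriv T F) (ht : t ∈ Icc 0 T) (u : E) :
    IntervalIntegrable (fun s => supportFun (interiorDeriv T F s) u) volume 0 t ∧
    ∫ s in 0..t, supportFun (interiorDeriv T F s) u = supportFun (F t) u - supportFun (F 0) u := by
  obtain ⟨M, hM0, hM⟩ := hFb.exists_dist_interiorDeriv_le
  have hint : IntervalIntegrable (fun s => supportFun (interiorDeriv T F s) u) volume 0 t := by
    rw [intervalIntegrable_iff]
    refine Measure.integrableOn_of_bounded (M := ‖u‖ * M) (by simp)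
      (measurable_supportFun_interiorDeriv hF u).aestronglyMeasurable
      (ae_of_all _ fun s => ?_)
    have := abs_supportFun_sub_le (interiorDeriv T F s) 0 u
    rw [supportFun_zero, sub_zero] at this
    exact this.trans (mul_le_mul_of_nonneg_left (hM s) (norm_nonneg u))
  refine ⟨hint, intervalIntegral.integral_eq_sub_of_hasDerivAt_of_le ht.1
    (f := fun s => supportFun (F s) u) ?_ ?_ hint⟩
  · exact fun s hs => ((hasDerivWithinAt_supportFun hF ⟨hs.1, hs.2.trans ht.2⟩
      u).continuousWithinAt).mono (Icc_subset_Icc_right ht.2)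
  · intro s hs
    have hs' : s ∈ Ioo 0 T := ⟨hs.1, hs.2.trans_le ht.2⟩
    rw [interiorDeriv, if_pos hs']
    exact hasDerivAt_supportFun hF hs' u

/-- Integrate `⟪u, φ s⟫ ≤ supportFun (interiorDeriv T F s) u`, whose right side is the derivative of
`supportFun (F s) u`; a point obeying all support inequalities lies in the body. -/
lemma add_integral_mem [CompleteSpace E] {T t : ℝ} {F : ℝ → ConvexBody E}
    (hF : HukuharaDifferentiable T F) (hFb : BoundedHukuharaDeriv T F) (ht : t ∈ Icc 0 T)
    {c : E} (hc : c ∈ F 0) {φ : ℝ → E} (hφ : IntervalIntegrable φ volume 0 t)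
    (hmem : ∀ s, φ s ∈ interiorDeriv T F s) : c + ∫ s in 0..t, φ s ∈ F t := by
  refine mem_of_inner_le_supportFun fun u => ?_
  obtain ⟨hint, h⟩ := integral_supportFun_interiorDeriv hF hFb ht u
  rw [inner_add_right, ← innerSL_apply_apply (𝕜 := ℝ) u (∫ s in 0..t, φ s),
    ← ContinuousLinearMap.intervalIntegral_comp_comm _ hφ]
  have h₁ : ∫ s in 0..t, innerSL ℝ u (φ s) ≤ ∫ s in 0..t, supportFun (interiorDeriv T F s) u :=
    intervalIntegral.integral_mono_on ht.1 
      ⟨(innerSL ℝ u).integrable_comp hφ.1, (innerSL ℝ u).integrable_comp hφ.2⟩ hint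
      fun s _ => inner_le_supportFun (hmem s) u
  linarith [inner_le_supportFun hc u]

end Hukuhara

/-- Extend a partition of `[a, b]` by one more division point `c > b`. -/
def Partition.append {a b c : ℝ} (P : Partition a b) (h : b < c) : Partition a c where
  m := P.m + 1
  pt i := if i ≤ P.m then P.pt i else c
  pt_zero := by simp [P.pt_zero]
  pt_last := by simp
  lt_succ i hi := by
    rcases (Nat.lt_succ_iff.1 hi).lt_or_eq with h' | rfl
    · rw [if_pos h'.le, if_pos (Nat.succ_le_of_lt h')]
      exact P.lt_succ i h'
    · simp [P.pt_last, h]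

/-- The trivial partition of a one-point interval. -/
def Partition.point (a : ℝ) : Partition a a where
  m := 0
  pt _ := a
  pt_zero := rfl
  pt_last := rfl
  lt_succ i hi := absurd hi i.not_lt_zero

lemma Partition.nonempty {a b : ℝ} (h : a ≤ b) : Nonempty (Partition a b) := by
  rcases h.eq_or_lt with rfl | h
  · exact ⟨point a⟩
  · exact ⟨(point a).append h⟩

lemma Partition.pt_mono {a b : ℝ} (P : Partition a b) {i j : ℕ} (hij : i ≤ j) (hj : j ≤ P.m) :
    P.pt i ≤ P.pt j := by
  induction j, hij using Nat.le_induction with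
  | base => exact le_rfl
  | succ j _ ih => exact (ih (by omega)).trans (P.lt_succ j (by omega)).le

lemma Partition.pt_mem {a b : ℝ} (P : Partition a b) {i : ℕ} (hi : i ≤ P.m) :
    P.pt i ∈ Icc a b :=
  ⟨P.pt_zero.symm.trans_le (P.pt_mono (Nat.zero_le i) hi),
    (P.pt_mono hi le_rfl).trans_eq P.pt_last⟩

/-! ### Riesz variation and absolute continuity. -/

section RieszVariation

variable {X : Type*} [PseudoMetricSpace X]

lemma rieszVariation_add_le (p : ℝ) (f : ℝ → X) {a b c : ℝ} (hab : a ≤ b) (hbc : b < c) :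
    rieszVariation p f a b + ENNReal.ofReal (dist (f b) (f c) ^ p / (c - b) ^ (p - 1)) ≤
      rieszVariation p f a c := by
  have := Partition.nonempty hab
  rw [rieszVariation, ENNReal.iSup_add]
  refine iSup_le fun P => ?_
  rw [← ENNReal.ofReal_add (Finset.sum_nonneg fun i hi =>
    div_nonneg (Real.rpow_nonneg dist_nonneg _) (Real.rpow_nonneg
      (sub_nonneg.2 (P.lt_succ i (Finset.mem_range.1 hi)).le) _))
    (div_nonneg (Real.rpow_nonneg dist_nonneg _) (Real.rpow_nonneg (sub_nonneg.2 hbc.le) _))]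
  refine le_of_eq_of_le ?_ (le_iSup _ (P.append hbc))
  congr 1
  change _ = ∑ i ∈ Finset.range (P.m + 1), _
  rw [Finset.sum_range_succ]
  congr 1
  · refine Finset.sum_congr rfl fun i hi => ?_
    have hi := Finset.mem_range.1 hi
    simp only [Partition.append, if_pos hi.le, if_pos (Nat.succ_le_of_lt hi)]
  · simp [Partition.append, P.pt_last]

lemma rieszVariation_mono (p : ℝ) (f : ℝ → X) {a b c : ℝ} (hab : a ≤ b) (hbc : b ≤ c) :
    rieszVariation p f a b ≤ rieszVariation p f a c := by
  rcases hbc.eq_or_lt with rfl | hbc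
  · exact le_rfl
  · exact le_self_add.trans (rieszVariation_add_le p f hab hbc)

lemma dist_rpow_le_of_rieszVariation {p : ℝ} {f : ℝ → X} {a b s t : ℝ}
    (hf : rieszVariation p f a b < ∞) (has : a ≤ s) (hst : s < t) (htb : t ≤ b) :
    dist (f s) (f t) ^ p ≤
      ((rieszVariation p f a t).toReal - (rieszVariation p f a s).toReal) * (t - s) ^ (p - 1) := by
  have ht := (rieszVariation_mono p f (has.trans hst.le) htb).trans_lt hf
  have hs := (rieszVariation_mono p f has hst.le).trans_lt ht
  have h := ENNReal.toReal_mono ht.ne (rieszVariation_add_le p f has hst)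
  rw [ENNReal.toReal_add hs.ne ENNReal.ofReal_ne_top, ENNReal.toReal_ofReal
    (div_nonneg (Real.rpow_nonneg dist_nonneg _) (Real.rpow_nonneg (sub_nonneg.2 hst.le) _))] at h
  rw [← div_le_iff₀ (Real.rpow_pos_of_pos (sub_pos.2 hst) _)]
  linarith

/-- Either `x ≤ K * l`, or `x ^ (p - 1)` exceeds `(K * l) ^ (p - 1)` and one factor `l ^ (p - 1)`
cancels. The bound is linear in `l` and `v`, so it can be summed over intervals without Hölder's
inequality. -/
lemma le_of_rpow_le_mul_rpow {p x v l K : ℝ} (hp : 1 < p) (hl : 0 < l) (hK : 0 < K)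
    (hv : 0 ≤ v) (h : x ^ p ≤ v * l ^ (p - 1)) : x ≤ K * l + v / K ^ (p - 1) := by
  have hKp := Real.rpow_pos_of_pos hK (p - 1)
  have hlp := Real.rpow_pos_of_pos hl (p - 1)
  by_cases hxl : x ≤ K * l
  · exact hxl.trans (le_add_of_nonneg_right (by positivity))
  · push Not at hxl
    refine le_add_of_nonneg_of_le (by positivity) ?_
    have hx' : 0 < x := lt_trans (by positivity) hxl
    have h₁ : (K * l) ^ (p - 1) ≤ x ^ (p - 1) :=
      Real.rpow_le_rpow (by positivity) hxl.le (by linarith)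
    have h₂ : x ^ p = x * x ^ (p - 1) := by
      rw [Real.rpow_sub_one hx'.ne']
      field_simp
    rw [le_div_iff₀ hKp]
    rw [Real.mul_rpow hK.le hl.le] at h₁
    rw [h₂] at h
    refine le_of_mul_le_mul_right ?_ hlp
    calc x * K ^ (p - 1) * l ^ (p - 1) = x * (K ^ (p - 1) * l ^ (p - 1)) := by ring
      _ ≤ x * x ^ (p - 1) := by gcongr
      _ ≤ _ := h

/-- Remove the interval with the largest right endpoint: by disjointness all others end at or before
its left endpoint, which becomes the new `c`. -/
lemma sum_sub_le_of_pairwiseDisjoint {ι : Type*} {V : ℝ → ℝ} {a b : ℝ}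
    (hV : MonotoneOn V (Icc a b)) (s : Finset ι) (x y : ι → ℝ) (c : ℝ) (hac : a ≤ c) (hcb : c ≤ b)
    (hs : ∀ i ∈ s, a ≤ x i ∧ x i < y i ∧ y i ≤ c)
    (hd : (s : Set ι).PairwiseDisjoint fun i => Ioc (x i) (y i)) :
    ∑ i ∈ s, (V (y i) - V (x i)) ≤ V c - V a := by
  classical
  induction s using Finset.induction_on_max_value y generalizing c with
  | empty => simpa using hV ⟨le_rfl, hac.trans hcb⟩ ⟨hac, hcb⟩ hac
  | insert i s hi hmax ih =>
    obtain ⟨hax, hxy, hyc⟩ := hs i (Finset.mem_insert_self i s)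
    rw [Finset.sum_insert hi]
    have hV' := hV ⟨hax.trans hxy.le, hyc.trans hcb⟩ ⟨hac, hcb⟩ hyc
    have := ih (x i) hax (by linarith) (fun j hj => ?_)
      (hd.subset (by simp))
    · linarith
    · obtain ⟨h₁, h₂, -⟩ := hs j (Finset.mem_insert_of_mem hj)
      refine ⟨h₁, h₂, ?_⟩
      by_contra! hlt
      have hij : i ≠ j := fun h => hi (h ▸ hj)
      exact Set.disjoint_left.1 (hd (by simp) (by simp [hj]) hij) ⟨hlt, hmax j hj⟩ ⟨h₂, le_rfl⟩

/-- With `V` the variation on `[a, t]`, the increments of `V` over disjoint intervals sum to at most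
`V b - V a`. A large `K` makes their share at most `ε / 2`; then the total length is taken below `ε
/ (2K)`. -/
lemma absolutelyContinuousOnInterval_of_rieszVariation {p : ℝ} (hp : 1 < p) {f : ℝ → X} {a b : ℝ}
    (hab : a ≤ b) (hf : rieszVariation p f a b < ∞) : AbsolutelyContinuousOnInterval f a b := by
  rw [absolutelyContinuousOnInterval_iff]
  intro ε hε
  set V : ℝ → ℝ := fun t => (rieszVariation p f a t).toReal with hVdef
  have hV : MonotoneOn V (Icc a b) := fun s hs t ht hst =>
    ENNReal.toReal_mono ((rieszVariation_mono p f ht.1 ht.2).trans_lt hf).ne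
      (rieszVariation_mono p f hs.1 hst)
  have hVab : 0 ≤ V b - V a := sub_nonneg.2 (hV ⟨le_rfl, hab⟩ ⟨hab, le_rfl⟩ hab)
  obtain ⟨K, hK0, hK⟩ : ∃ K : ℝ, 0 < K ∧ (V b - V a) / K ^ (p - 1) ≤ ε / 2 := by
    have h₁ := (tendsto_rpow_atTop (y := p - 1) (by linarith)).const_div_atTop (V b - V a)
    obtain ⟨K, h₂, h₃⟩ := ((h₁.eventually_le_const (half_pos hε)).and (eventually_gt_atTop 0)).exists
    exact ⟨K, h₃, h₂⟩
  refine ⟨ε / 2 / K, by positivity, ?_⟩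
  rintro ⟨n, I⟩ ⟨hmem, hdisj⟩ hlen
  simp only [Finset.mem_range, uIcc_of_le hab] at hmem hlen hdisj ⊢
  have hle : ∀ i ∈ Finset.range n, dist (f (I i).1) (f (I i).2) ≤
      K * dist (I i).1 (I i).2 +
        (V (max (I i).1 (I i).2) - V (min (I i).1 (I i).2)) / K ^ (p - 1) := by
    intro i hi
    obtain ⟨h₁, h₂⟩ := hmem i (Finset.mem_range.1 hi)
    have main : ∀ s ∈ Icc a b, ∀ t ∈ Icc a b, s < t →
        dist (f s) (f t) ≤ K * dist s t + (V t - V s) / K ^ (p - 1) := fun s hs t ht hst => by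
      rw [dist_comm s, Real.dist_eq, abs_of_pos (sub_pos.2 hst)]
      exact le_of_rpow_le_mul_rpow hp (sub_pos.2 hst) hK0
        (sub_nonneg.2 (hV hs ht hst.le)) (dist_rpow_le_of_rieszVariation hf hs.1 hst ht.2)
    rcases lt_trichotomy (I i).1 (I i).2 with h | h | h
    · rw [max_eq_right h.le, min_eq_left h.le]
      exact main _ h₁ _ h₂ h
    · simp [h]
    · rw [max_eq_left h.le, min_eq_right h.le, dist_comm, dist_comm (I i).1]
      exact main _ h₂ _ h₁ h
  have hsum : ∑ i ∈ Finset.range n, (V (max (I i).1 (I i).2) - V (min (I i).1 (I i).2)) ≤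
      V b - V a := by
    -- Degenerate intervals contribute nothing and are dropped, because the summation lemma needs
    -- strict inequalities.
    rw [← Finset.sum_filter_of_ne (p := fun i => (I i).1 ≠ (I i).2)
      fun i _ h h' => h (by simp [h'])]
    refine sum_sub_le_of_pairwiseDisjoint hV _ _ _ b hab le_rfl (fun i hi => ?_)
      (hdisj.subset (Finset.coe_subset.2 (Finset.filter_subset _ _)))
    obtain ⟨hi, hne⟩ := Finset.mem_filter.1 hi
    obtain ⟨h₁, h₂⟩ := hmem i (Finset.mem_range.1 hi)
    exact ⟨le_min h₁.1 h₂.1, min_lt_max.2 hne, max_le h₁.2 h₂.2⟩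
  calc ∑ i ∈ Finset.range n, dist (f (I i).1) (f (I i).2)
      ≤ ∑ i ∈ Finset.range n, (K * dist (I i).1 (I i).2 +
        (V (max (I i).1 (I i).2) - V (min (I i).1 (I i).2)) / K ^ (p - 1)) :=
        Finset.sum_le_sum hle
    _ = K * ∑ i ∈ Finset.range n, dist (I i).1 (I i).2 +
        (∑ i ∈ Finset.range n, (V (max (I i).1 (I i).2) - V (min (I i).1 (I i).2))) /
          K ^ (p - 1) := by
        rw [Finset.sum_add_distrib, Finset.mul_sum, Finset.sum_div]
    _ < ε / 2 + ε / 2 := by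
        refine add_lt_add_of_lt_of_le ?_ (le_trans ?_ hK)
        · rwa [lt_div_iff₀' hK0] at hlen
        · gcongr
    _ = ε := add_halves ε

lemma rieszVariation_lt_top_of_dist_le {p M : ℝ} (hp : 1 < p) (hM : 0 ≤ M) {f : ℝ → X} {a b : ℝ}
    (h : ∀ s ∈ Icc a b, ∀ t ∈ Icc a b, s ≤ t → dist (f s) (f t) ≤ M * (t - s)) :
    rieszVariation p f a b < ∞ := by
  refine lt_of_le_of_lt (iSup_le fun P => ENNReal.ofReal_le_ofReal ?_)
    (ENNReal.ofReal_lt_top (r := M ^ p * (b - a)))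
  calc _ ≤ ∑ i ∈ Finset.range P.m, M ^ p * (P.pt (i + 1) - P.pt i) := by
        refine Finset.sum_le_sum fun i hi => ?_
        have hi := Finset.mem_range.1 hi
        have hlt := sub_pos.2 (P.lt_succ i hi)
        rw [div_le_iff₀ (Real.rpow_pos_of_pos hlt _)]
        have h₁ := h _ (P.pt_mem hi.le) _ (P.pt_mem hi) (P.lt_succ i hi).le
        refine (Real.rpow_le_rpow dist_nonneg h₁ (by linarith)).trans_eq ?_
        rw [Real.mul_rpow hM hlt.le, Real.rpow_sub_one hlt.ne']
        field_simp
    _ = M ^ p * (b - a) := by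
        rw [← Finset.mul_sum, Finset.sum_range_sub, P.pt_last, P.pt_zero]

end RieszVariation

/-! ### The fundamental theorem for vector-valued absolutely continuous functions. -/

section FundamentalTheorem

variable {E : Type*} [NormedAddCommGroup E] [InnerProductSpace ℝ E]

lemma absolutelyContinuousOnInterval_inner {f : ℝ → E} {a b : ℝ}
    (hf : AbsolutelyContinuousOnInterval f a b) (u : E) :
    AbsolutelyContinuousOnInterval (fun t => inner ℝ u (f t)) a b := by
  have h := Tendsto.const_mul ‖u‖ hf
  rw [mul_zero] at h
  refine squeeze_zero (fun _ => Finset.sum_nonneg fun _ _ => dist_nonneg) (fun I => ?_) h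
  rw [Finset.mul_sum]
  refine Finset.sum_le_sum fun i _ => ?_
  rw [dist_eq_norm, dist_eq_norm, ← inner_sub_right]
  exact norm_inner_le_norm _ _

lemma integral_eq_sub_of_absolutelyContinuousOnInterval [CompleteSpace E] {f φ : ℝ → E} {a b : ℝ}
    (hf : AbsolutelyContinuousOnInterval f a b) (hφ : IntervalIntegrable φ volume a b)
    (h : ∀ᵐ s, s ∈ uIcc a b → HasDerivAt f (φ s) s) : ∫ s in a..b, φ s = f b - f a := by
  refine ext_inner_left ℝ fun u => ?_
  rw [← innerSL_apply_apply (𝕜 := ℝ) u (∫ s in a..b, φ s),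
    ← ContinuousLinearMap.intervalIntegral_comp_comm _ hφ, inner_sub_right,
    ← (absolutelyContinuousOnInterval_inner hf u).integral_deriv_eq_sub]
  refine intervalIntegral.integral_congr_ae ?_
  filter_upwards [h] with s hs hsab
  exact ((innerSL ℝ u).hasFDerivAt.comp_hasDerivAt s (hs (uIoc_subset_uIcc hsab))).deriv.symm

end FundamentalTheorem

/-! ### Young integrals of primitives by integration by parts. -/

section Young

variable {E : Type*} [NormedAddCommGroup E] [NormedSpace ℝ E]

lemma HasYoungIntegral.congr {f k : ℝ → E} {g : ℝ → ℝ} {a b : ℝ} {I : E}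
    (hf : HasYoungIntegral f g a b I) (h : EqOn k f (Icc a b)) : HasYoungIntegral k g a b I := by
  intro ε hε
  obtain ⟨δ, hδ, H⟩ := hf ε hε
  refine ⟨δ, hδ, fun P hP => ?_⟩
  have : riemannSum k g P = riemannSum f g P :=
    Finset.sum_congr rfl fun i hi => by rw [h (P.pt_mem (Finset.mem_range.1 hi).le)]
  rw [this]
  exact H P hP

lemma HasYoungIntegral.add {f k : ℝ → E} {g : ℝ → ℝ} {a b : ℝ} {I J : E}
    (hf : HasYoungIntegral f g a b I) (hk : HasYoungIntegral k g a b J) :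
    HasYoungIntegral (fun s => f s + k s) g a b (I + J) := by
  intro ε hε
  obtain ⟨δ₁, hδ₁, H₁⟩ := hf (ε / 2) (half_pos hε)
  obtain ⟨δ₂, hδ₂, H₂⟩ := hk (ε / 2) (half_pos hε)
  refine ⟨min δ₁ δ₂, lt_min hδ₁ hδ₂, fun P hP => ?_⟩
  have : riemannSum (fun s => f s + k s) g P - (I + J) =
      (riemannSum f g P - I) + (riemannSum k g P - J) := by
    simp only [riemannSum, smul_add, Finset.sum_add_distrib]
    abel
  rw [this]
  calc _ ≤ _ := norm_add_le _ _
    _ < ε / 2 + ε / 2 := add_lt_add (H₁ P fun i hi => (hP i hi).trans_le (min_le_left _ _))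
        (H₂ P fun i hi => (hP i hi).trans_le (min_le_right _ _))
    _ = ε := add_halves ε

/-- The Young integral over `[a, r]` of the primitive `c + ∫ₐ ψ`, as integration by parts gives
it. -/
noncomputable def partsIntegral (c : E) (ψ : ℝ → E) (g : ℝ → ℝ) (a r : ℝ) : E :=
  (g r - g a) • c + ∫ s in a..r, (g r - g s) • ψ s

lemma intervalIntegrable_sub_smul {ψ : ℝ → E} {g : ℝ → ℝ} {a b : ℝ} (hab : a ≤ b)
    (hψ : IntervalIntegrable ψ volume a b) (hg : ContinuousOn g (Icc a b)) (x : ℝ) {r t : ℝ}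
    (hr : r ∈ Icc a b) (ht : t ∈ Icc a b) :
    IntervalIntegrable (fun s => (x - g s) • ψ s) volume r t := by
  have h : IntervalIntegrable (fun s => (x - g s) • ψ s) volume a b :=
    hψ.continuousOn_smul (by rw [uIcc_of_le hab]; fun_prop)
  refine h.mono_set ?_
  rw [uIcc_of_le hab]
  exact uIcc_subset_Icc hr ht

/-- The increment over `[r, t]` is a left-endpoint Riemann term plus an error integral, which is
small when `g` varies little on `[r, t]`. -/
lemma partsIntegral_sub {c : E} {ψ : ℝ → E} {g : ℝ → ℝ} {a b r t : ℝ} (hab : a ≤ b)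
    (hψ : IntervalIntegrable ψ volume a b) (hg : ContinuousOn g (Icc a b))
    (hr : r ∈ Icc a b) (ht : t ∈ Icc a b) :
    partsIntegral c ψ g a t - partsIntegral c ψ g a r =
      (g t - g r) • (c + ∫ s in a..r, ψ s) + ∫ s in r..t, (g t - g s) • ψ s := by
  have ha : a ∈ Icc a b := ⟨le_rfl, hab⟩
  have hint := fun x {r t} => intervalIntegrable_sub_smul (r := r) (t := t) hab hψ hg x
  have h₁ := intervalIntegral.integral_add_adjacent_intervals (hint (g t) ha hr) (hint (g t) hr ht)
  have h₂ : (∫ s in a..r, (g t - g s) • ψ s) - ∫ s in a..r, (g r - g s) • ψ s =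
      (g t - g r) • ∫ s in a..r, ψ s := by
    rw [← intervalIntegral.integral_sub (hint _ ha hr) (hint _ ha hr),
      ← intervalIntegral.integral_smul]
    refine intervalIntegral.integral_congr fun s _ => ?_
    simp only [← sub_smul]
    congr 1
    ring
  rw [partsIntegral, partsIntegral, ← h₁, smul_add, ← h₂, show g t - g a = (g t - g r) + (g r - g a)
    by ring, add_smul]
  abel

/-- The errors of the cells add up to at most the oscillation of `g` on a cell times `∫ ‖ψ‖`, and
uniform continuity of `g` makes this small. -/
lemma hasYoungIntegral_primitive {c : E} {ψ : ℝ → E} {g : ℝ → ℝ} {a b : ℝ} (hab : a ≤ b)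
    (hψ : IntervalIntegrable ψ volume a b) (hg : ContinuousOn g (Icc a b)) :
    HasYoungIntegral (fun t => c + ∫ s in a..t, ψ s) g a b (partsIntegral c ψ g a b) := by
  intro ε hε
  set N := ∫ s in a..b, ‖ψ s‖ with hN
  have hN0 : 0 ≤ N := intervalIntegral.integral_nonneg hab fun _ _ => norm_nonneg _
  have hη : 0 < ε / (N + 1) := by positivity
  obtain ⟨δ, hδ, H⟩ := Metric.uniformContinuousOn_iff.1
    (isCompact_Icc.uniformContinuousOn_of_continuous hg) _ hη
  refine ⟨δ, hδ, fun P hP => ?_⟩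
  have hsub : ∀ {r t}, r ∈ Icc a b → t ∈ Icc a b → uIcc r t ⊆ uIcc a b := fun hr ht => by
    rw [uIcc_of_le hab]
    exact uIcc_subset_Icc hr ht
  have ha : a ∈ Icc a b := ⟨le_rfl, hab⟩
  have key : ∀ j ≤ P.m, ‖∑ i ∈ Finset.range j, (g (P.pt (i + 1)) - g (P.pt i)) •
      (c + ∫ s in a..P.pt i, ψ s) - partsIntegral c ψ g a (P.pt j)‖ ≤
      ε / (N + 1) * ∫ s in a..P.pt j, ‖ψ s‖ := by
    intro j hj
    induction j with
    | zero => simp [partsIntegral, P.pt_zero]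
    | succ j ih =>
      have hr := P.pt_mem (i := j) (by omega)
      have ht := P.pt_mem hj
      have hlt := P.lt_succ j hj
      have hψ₁ := (hψ.mono_set (hsub ha hr)).norm
      have hψ₂ := (hψ.mono_set (hsub hr ht)).norm
      have hstep := partsIntegral_sub (c := c) hab hψ hg hr ht
      have herr : ‖∫ s in P.pt j..P.pt (j + 1), (g (P.pt (j + 1)) - g s) • ψ s‖ ≤
          ε / (N + 1) * ∫ s in P.pt j..P.pt (j + 1), ‖ψ s‖ := by
        rw [← intervalIntegral.integral_const_mul]
        refine intervalIntegral.norm_integral_le_of_norm_le hlt.le ?_ (hψ₂.const_mul _)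
        refine ae_of_all _ fun s hs => ?_
        rw [norm_smul, ← dist_eq_norm]
        refine mul_le_mul_of_nonneg_right (H _ ht s ⟨hr.1.trans hs.1.le, hs.2.trans ht.2⟩ ?_).le
          (norm_nonneg _)
        rw [Real.dist_eq, abs_of_nonneg (sub_nonneg.2 hs.2)]
        exact (sub_lt_sub_left hs.1 _).trans (hP j hj)
      rw [Finset.sum_range_succ, ← intervalIntegral.integral_add_adjacent_intervals hψ₁ hψ₂,
        mul_add]
      refine le_trans ?_ (add_le_add (ih (by omega)) herr)
      rw [← norm_neg (∫ s in P.pt j..P.pt (j + 1), (g (P.pt (j + 1)) - g s) • ψ s)]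
      refine le_of_eq_of_le ?_ (norm_add_le _ _)
      rw [← sub_eq_iff_eq_add'.2 hstep]
      congr 1
      abel
  have h := key P.m le_rfl
  rw [P.pt_last] at h
  refine h.trans_lt ?_
  rw [div_mul_eq_mul_div, div_lt_iff₀ (by positivity)]
  nlinarith

lemma norm_partsIntegral_le {c : E} {ψ : ℝ → E} {g : ℝ → ℝ} {a r B ε : ℝ} (har : a ≤ r)
    (hB : ∀ s ∈ Icc a r, |g r - g s| ≤ B) (hψ : ∀ᵐ s, s ∈ Icc a r → ‖ψ s‖ ≤ ε) :
    ‖partsIntegral c ψ g a r‖ ≤ B * ‖c‖ + B * ε * (r - a) := by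
  have hB0 : 0 ≤ B := (abs_nonneg _).trans (hB a ⟨le_rfl, har⟩)
  refine (norm_add_le _ _).trans (add_le_add ?_ ?_)
  · rw [norm_smul]
    exact mul_le_mul_of_nonneg_right (hB a ⟨le_rfl, har⟩) (norm_nonneg _)
  · have := intervalIntegral.norm_integral_le_of_norm_le_const_ae (a := a) (b := r) (C := B * ε)
      (f := fun s => (g r - g s) • ψ s) ?_
    · rwa [abs_of_nonneg (sub_nonneg.2 har)] at this
    · filter_upwards [hψ] with s hs hs'
      rw [uIoc_of_le har] at hs'
      have hs'' := Ioc_subset_Icc_self hs'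
      rw [norm_smul]
      exact mul_le_mul (hB s hs'') (hs hs'') (norm_nonneg _) hB0

end Young

/-! ### Transferring selections and integrals from `F` to `G`. -/

section Transfer

variable {E : Type*} [NormedAddCommGroup E] [InnerProductSpace ℝ E] [FiniteDimensional ℝ E]
  [MeasurableSpace E] [BorelSpace E]

lemma exists_integralSelections_near {p T : ℝ} (hp : 1 < p) (hT : 0 ≤ T) {F G : ℝ → ConvexBody E}
    (hG : HukuharaDifferentiable T G) (hGb : BoundedHukuharaDeriv T G) {ε : ℝ}
    (hD : ∀ t ∈ Icc 0 T, dist (hukuharaDeriv T F t) (hukuharaDeriv T G t) ≤ ε)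
    {f : ℝ → E} (hf : f ∈ integralSelections p T F) :
    ∃ k ∈ integralSelections p T G, ∃ (c : E) (ψ : ℝ → E), ‖c‖ ≤ dist (F 0) (G 0) ∧
      IntervalIntegrable ψ volume 0 T ∧ (∀ᵐ s, s ∈ Icc 0 T → ‖ψ s‖ ≤ ε) ∧
      ∀ t ∈ Icc 0 T, k t = f t + (c + ∫ s in 0..t, ψ s) := by
  obtain ⟨⟨hvar, hsel⟩, φ, ⟨hφp, hφ⟩, hderiv⟩ := hf
  obtain ⟨M, hM0, hM⟩ := hGb.exists_dist_interiorDeriv_le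
  obtain ⟨c₀, hc₀, hfc₀⟩ := exists_mem_dist_le (B := G 0) (hsel 0 ⟨le_rfl, hT⟩)
  -- The projection needs a genuinely measurable input, so `φ` is replaced by an almost everywhere
  -- equal representative.
  set φ' := hφp.aestronglyMeasurable.mk φ
  have hφφ' : φ =ᵐ[volume.restrict (Icc 0 T)] φ' := hφp.aestronglyMeasurable.ae_eq_mk
  set z : ℝ → E := fun s => nearestPoint (interiorDeriv T G s) (φ' s) with hz
  have hzm : Measurable z := measurable_nearestPoint (measurable_supportFun_interiorDeriv hG)
    hφp.aestronglyMeasurable.stronglyMeasurable_mk.measurable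
  have hzmem : ∀ s, z s ∈ interiorDeriv T G s := fun s => nearestPoint_mem _ _
  have hzM : ∀ s, ‖z s‖ ≤ M := fun s => (norm_le_dist_zero (hzmem s)).trans (hM s)
  have hzint : ∀ a b, IntervalIntegrable z volume a b := fun a b => by
    rw [intervalIntegrable_iff]
    exact Measure.integrableOn_of_bounded (M := M) (by simp) hzm.aestronglyMeasurable
      (ae_of_all _ hzM)
  have hφint : IntervalIntegrable φ volume 0 T := by
    rw [intervalIntegrable_iff_integrableOn_Icc_of_le hT]
    exact hφp.integrable (by simpa using hp.le)
  have hsub : ∀ {t}, t ∈ Icc 0 T → uIcc 0 t ⊆ uIcc 0 T := fun ht => by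
    rw [uIcc_of_le hT]
    exact uIcc_subset_Icc ⟨le_rfl, hT⟩ ht
  have hFTC : ∀ t ∈ Icc 0 T, ∫ s in 0..t, φ s = f t - f 0 := fun t ht => by
    refine integral_eq_sub_of_absolutelyContinuousOnInterval
      ((absolutelyContinuousOnInterval_of_rieszVariation hp hT hvar).mono (hsub ht))
      (hφint.mono_set (hsub ht)) ?_
    filter_upwards [(ae_restrict_iff' measurableSet_Icc).1 hderiv] with s hs hs'
    exact hs (uIcc_of_le hT ▸ hsub ht hs')
  refine ⟨fun t => c₀ + ∫ s in 0..t, z s, ⟨⟨?_, ?_⟩, z, ⟨?_, ?_⟩, ?_⟩, c₀ - f 0,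
    fun s => z s - φ s, ?_, (hzint 0 T).sub hφint, ?_, ?_⟩
  · refine rieszVariation_lt_top_of_dist_le hp hM0 fun s _ t _ hst => ?_
    rw [dist_add_left, dist_comm, dist_eq_norm,
      intervalIntegral.integral_interval_sub_left (hzint _ _) (hzint _ _)]
    have := intervalIntegral.norm_integral_le_of_norm_le_const (a := s) (b := t) fun r _ => hzM r
    rwa [abs_of_nonneg (sub_nonneg.2 hst)] at this
  · exact fun t ht => add_integral_mem hG hGb ht hc₀ (hzint 0 t) hzmem
  · exact MemLp.of_bound hzm.aestronglyMeasurable M (ae_of_all _ hzM)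
  · filter_upwards [ae_restrict_Icc_mem_Ioo T] with s hs
    have := hzmem s
    rwa [interiorDeriv, if_pos hs] at this
  · rw [ae_restrict_iff' measurableSet_Icc]
    filter_upwards [(hzint 0 T).ae_hasDerivAt_integral] with s hs hsT
    rw [uIcc_of_le hT] at hs
    exact (hs hsT 0 ⟨le_rfl, hT⟩).const_add c₀
  · rwa [← dist_eq_norm, dist_comm]
  · rw [← ae_restrict_iff' measurableSet_Icc]
    filter_upwards [ae_restrict_Icc_mem_Ioo T, hφφ', hφ] with s hs hs' hφs
    rw [hs'] at hφs ⊢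
    obtain ⟨y, hy, hy'⟩ := exists_mem_dist_le (B := hukuharaDeriv T G s) hφs
    rw [norm_sub_rev]
    refine (norm_sub_nearestPoint_le (φ' s) ?_).trans
      ((dist_eq_norm (φ' s) y ▸ hy').trans (hD s (Ioo_subset_Icc_self hs)))
    rwa [interiorDeriv, if_pos hs]
  · intro t ht
    simp only
    rw [intervalIntegral.integral_sub (hzint 0 t) (hφint.mono_set (hsub ht)), hFTC t ht]
    abel

/-- The integral of `k` exists because `k` is `f`, whose integral is given, plus a primitive. -/
lemma exists_youngIntegral_near {p T : ℝ} (hp : 1 < p) {F G : ℝ → ConvexBody E}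
    (hG : HukuharaDifferentiable T G) (hGb : BoundedHukuharaDeriv T G) {ε : ℝ} (hε : 0 ≤ ε)
    (h0 : dist (F 0) (G 0) ≤ ε)
    (hD : ∀ t ∈ Icc 0 T, dist (hukuharaDeriv T F t) (hukuharaDeriv T G t) ≤ ε)
    {g : ℝ → ℝ} (hg : ContinuousOn g (Icc 0 T)) {B : ℝ}
    (hB : ∀ s ∈ Icc 0 T, ∀ t ∈ Icc 0 T, |g t - g s| ≤ B) {t : ℝ} (ht : t ∈ Icc 0 T) {I : E}
    (hI : ∃ f ∈ integralSelections p T F, HasYoungIntegral f g 0 t I) :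
    ∃ J, (∃ f ∈ integralSelections p T G, HasYoungIntegral f g 0 t J) ∧
      dist I J ≤ B * (1 + T) * ε := by
  obtain ⟨f, hf, hfI⟩ := hI
  have hT := ht.1.trans ht.2
  have hB0 : 0 ≤ B := (abs_nonneg _).trans (hB t ht t ht)
  obtain ⟨k, hk, c, ψ, hc, hψ, hψε, hkf⟩ := exists_integralSelections_near hp hT hG hGb hD hf
  have hsub : Icc 0 t ⊆ Icc 0 T := Icc_subset_Icc_right ht.2
  have hψt : IntervalIntegrable ψ volume 0 t := hψ.mono_set (by
    rwa [uIcc_of_le hT, uIcc_of_le ht.1])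
  refine ⟨I + partsIntegral c ψ g 0 t, ⟨k, hk, (hfI.add (hasYoungIntegral_primitive ht.1 hψt
    (hg.mono hsub))).congr fun s hs => hkf s (hsub hs)⟩, ?_⟩
  rw [dist_self_add_right]
  refine (norm_partsIntegral_le ht.1 (fun s hs => hB s (hsub hs) t ht)
    (hψε.mono fun s hs hs' => hs (hsub hs'))).trans ?_
  have h₁ : B * ‖c‖ ≤ B * ε := mul_le_mul_of_nonneg_left (hc.trans h0) hB0
  have h₂ : B * ε * (t - 0) ≤ B * ε * T := mul_le_mul_of_nonneg_left (by linarith [ht.2])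
    (mul_nonneg hB0 hε)
  linarith

lemma hausdorffEDist_setYoungIntegral_le {p T : ℝ} (hp : 1 < p) {F G : ℝ → ConvexBody E}
    (hF : HukuharaDifferentiable T F) (hFb : BoundedHukuharaDeriv T F)
    (hG : HukuharaDifferentiable T G) (hGb : BoundedHukuharaDeriv T G) {ε : ℝ} (hε : 0 ≤ ε)
    (h0 : dist (F 0) (G 0) ≤ ε)
    (hD : ∀ t ∈ Icc 0 T, dist (hukuharaDeriv T F t) (hukuharaDeriv T G t) ≤ ε)
    {g : ℝ → ℝ} (hg : ContinuousOn g (Icc 0 T)) {B : ℝ}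
    (hB : ∀ s ∈ Icc 0 T, ∀ t ∈ Icc 0 T, |g t - g s| ≤ B) {t : ℝ} (ht : t ∈ Icc 0 T) :
    Metric.hausdorffEDist (setYoungIntegral p T F g t) (setYoungIntegral p T G g t) ≤
      ENNReal.ofReal (B * (1 + T) * ε) := by
  rw [setYoungIntegral, setYoungIntegral, Metric.hausdorffEDist_closure]
  refine Metric.hausdorffEDist_le_of_mem_edist (fun I hI => ?_) fun I hI => ?_
  · obtain ⟨J, hJ, h⟩ := exists_youngIntegral_near hp hG hGb hε h0 hD hg hB ht hI
    exact ⟨J, hJ, edist_dist I J ▸ ENNReal.ofReal_le_ofReal h⟩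
  · obtain ⟨J, hJ, h⟩ := exists_youngIntegral_near hp hF hFb hε (dist_comm (F 0) _ ▸ h0)
      (fun s hs => dist_comm (hukuharaDeriv T F s) _ ▸ hD s hs) hg hB ht hI
    exact ⟨J, hJ, edist_dist I J ▸ ENNReal.ofReal_le_ofReal h⟩

end Transfer

end SetYoung

theorem corollary2 (d : ℕ) (T : ℝ) (hT : 0 < T) (p : ℝ) (hp : 1 < p)
    (α : ℝ≥0) (hα : 0 < α) (hα1 : α ≤ 1) (hpα : 1 < 1 / p + (α : ℝ))
    (g : ℝ → ℝ) (hg : ∃ K : ℝ≥0, HolderOnWith K α g (Icc 0 T))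
    (F : ℝ → ConvexBody (EuclideanSpace ℝ (Fin d)))
    (Fn : ℕ → ℝ → ConvexBody (EuclideanSpace ℝ (Fin d)))
    (hF : SetYoung.HukuharaDifferentiable T F) (hFb : SetYoung.BoundedHukuharaDeriv T F)
    (hFn : ∀ n, SetYoung.HukuharaDifferentiable T (Fn n))
    (hFnb : ∀ n, SetYoung.BoundedHukuharaDeriv T (Fn n))
    (h0 : Tendsto (fun n => Fn n 0) atTop (𝓝 (F 0)))
    (hD : Tendsto (fun n => ⨆ t ∈ Icc 0 T,
      edist (SetYoung.hukuharaDeriv T (Fn n) t) (SetYoung.hukuharaDeriv T F t)) atTop (𝓝 0)) :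
    Tendsto (fun n => ⨆ t ∈ Icc 0 T,
      Metric.hausdorffEDist (SetYoung.setYoungIntegral p T (Fn n) g t)
        (SetYoung.setYoungIntegral p T F g t)) atTop (𝓝 0) := by
  obtain ⟨K, hK⟩ := hg
  have hgc : ContinuousOn g (Icc 0 T) := hK.continuousOn hα
  obtain ⟨C, hC⟩ := isCompact_Icc.exists_bound_of_continuousOn hgc
  have hB : ∀ s ∈ Icc 0 T, ∀ t ∈ Icc 0 T, |g t - g s| ≤ C + C := fun s hs t ht =>
    (norm_sub_le _ _).trans (add_le_add (hC t ht) (hC s hs))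
  have hC0 : 0 ≤ C := (norm_nonneg _).trans (hC 0 ⟨le_rfl, hT.le⟩)
  rw [ENNReal.tendsto_nhds_zero]
  intro ε hε
  obtain ⟨r, hr, hrε⟩ := ENNReal.lt_iff_exists_nnreal_btwn.1 hε
  have hr0 : (0 : ℝ) < r := NNReal.coe_pos.2 (ENNReal.coe_pos.1 hr)
  have hL : 0 < (C + C) * (1 + T) + 1 := by positivity
  -- Chosen so that the estimate yields at most `r < ε`; the `+ 1` keeps the denominator positive
  -- when `C = 0`.
  set η : ℝ := r / ((C + C) * (1 + T) + 1)
  have hη : 0 < η := div_pos hr0 hL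
  have hηr : (C + C) * (1 + T) * η ≤ r := by
    have : ((C + C) * (1 + T) + 1) * η = r := mul_div_cancel₀ _ hL.ne'
    linarith
  filter_upwards [ENNReal.tendsto_nhds_zero.1 hD (ENNReal.ofReal η) (ENNReal.ofReal_pos.2 hη),
    (Metric.tendsto_nhds.1 h0 η hη)] with n hn hn0
  refine iSup₂_le fun t ht => ?_
  refine (SetYoung.hausdorffEDist_setYoungIntegral_le hp (hFn n) (hFnb n) hF hFb hη.le hn0.le
    (fun s hs => ?_) hgc hB ht).trans (le_trans ?_ hrε.le)
  · have := (le_iSup₂ (f := fun t (_ : t ∈ Icc 0 T) => edist (SetYoung.hukuharaDeriv T (Fn n) t)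
      (SetYoung.hukuharaDeriv T F t)) s hs).trans hn
    rwa [edist_dist, ENNReal.ofReal_le_ofReal_iff hη.le] at this
  · rw [← ENNReal.ofReal_coe_nnreal]
    exact ENNReal.ofReal_le_ofReal hηr
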